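/- Let $(R,\mathfrak m)$ be a Cohen–Macaulay (Noetherian) local ring of Krull dimension $2$ with infinite residue field, let $I$ be an $\mathfrak m$-primary ideal of $R$, and let $x\in I$ be a superficial element for $I$, that is, there is an integer $c\ge 1$ with $(I^{n+1}:x)\cap I^{c}=I^{n}$ for all $n\ge c$. Let $H_I(n)=\lambda(R/I^n)$ for $n\in\mathbb Z$ (with $I^n=R$ for $n\le 0$; $\lambda$ denotes length), let $P_I\in\mathbb Q[X]$ be the Hilbert–Samuel polynomial of $I$, i.e. the polynomial with $P_I(n)=H_I(n)$ for all $n\gg 0$, and let $$\operatorname{n}(I)=\min\{n\in\mathbb Z : P_I(t)=H_I(t)\text{ for all integers } t>n\}$$ be the postulation number of $I$. For an ideal $K$ let $\widetilde{K}=\bigcup_{n\ge 1}(K^{n+1}:K^n)$ be its Ratliff–Rush closure, and let $$\rho(I)=\min\{i\ge 1 : \widetilde{I^n}=I^n\text{ for all } n\ge i\}$$ be the stability index of the Ratliff–Rush filtration of $I$. A reduction of $I$ is an ideal $J\subseteq I$ with $JI^n=I^{n+1}$ for some $n\ge 0$; the least such $n$ is denoted $\operatorname{rd}_J(I)$, and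 the reduction number of $I$ is $\operatorname{rd}(I)=\min_J \operatorname{rd}_J(I)$, where $J$ runs over the reductions of $I$ that are minimal with respect to inclusion. If $\operatorname{n}(I)\neq\rho(I)-1$, then $\operatorname{rd}(I)\ge \operatorname{n}(I)+2$. -/

import Mathlib

namespace RatliffRush

open IsLocalRing Polynomial

variable {R : Type*} [CommRing R]

/-- A Noetherian local ring is Cohen-Macaulay if its depth equals its Krull dimension, i.e. if its
maximal ideal contains a regular sequence whose length is the dimension (no regular sequence in
the maximal ideal can be longer). -/
structure IsCohenMacaulayLocal (R : Type*) [CommRing R] [IsLocalRing R] : Prop where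
  noetherian : IsNoetherianRing R
  exists_regular : ∃ rs : List R, (∀ r ∈ rs, r ∈ maximalIdeal R) ∧
    RingTheory.Sequence.IsRegular R rs ∧ (rs.length : WithBot ℕ∞) = ringKrullDim R

/-- `I` is `𝔪`-primary: a primary ideal whose radical is the maximal ideal. -/
def IsMaxPrimary [IsLocalRing R] (I : Ideal R) : Prop :=
  I.IsPrimary ∧ I.radical = maximalIdeal R

/-- `x ∈ I` is superficial for `I`: there is a positive integer `c` such that
`(I ^ (n + 1) : x) ∩ I ^ c = I ^ n` for all `n ≥ c`. -/
def IsSuperficial (I : Ideal R) (x : R) : Prop :=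
  x ∈ I ∧ ∃ c : ℕ, 0 < c ∧ ∀ n : ℕ, c ≤ n → (I ^ (n + 1)).colon {x} ⊓ I ^ c = I ^ n

/-- The Ratliff-Rush closure `⋃_{n ≥ 1} (I ^ (n + 1) : I ^ n)`; the union is increasing in `n`, so
it is the supremum of these ideals. -/
def closure (I : Ideal R) : Ideal R :=
  ⨆ (n : ℕ) (_ : 1 ≤ n), (I ^ (n + 1)).colon ((I ^ n : Ideal R) : Set R)

/-- The stability index `ρ(I)`: the least `i ≥ 1` such that `I ^ n` is Ratliff-Rush closed for all
`n ≥ i`. -/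
noncomputable def stabilityIndex (I : Ideal R) : ℕ :=
  sInf {i : ℕ | 1 ≤ i ∧ ∀ n : ℕ, i ≤ n → closure (I ^ n) = I ^ n}

/-- The Hilbert-Samuel function `H_I(n) = λ(R / I ^ n)` for `n : ℤ`, where `I ^ n = R` for `n ≤ 0`
(so that `H_I(n) = 0` there). -/
noncomputable def hilbertFun (I : Ideal R) (n : ℤ) : ℕ :=
  (Module.length R (R ⧸ I ^ n.toNat)).toNat

open Classical in
/-- The Hilbert-Samuel polynomial `P_I`: the (unique) polynomial with rational coefficients such
that `P_I(n) = H_I(n)` for all large `n`; it exists for `𝔪`-primary ideals of Noetherian local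
rings, and the value is `0` if there is none. -/
noncomputable def hilbertPoly (I : Ideal R) : ℚ[X] :=
  if h : ∃ P : ℚ[X], ∃ N : ℤ, ∀ n : ℤ, N ≤ n → P.eval (n : ℚ) = (hilbertFun I n : ℚ)
  then h.choose else 0

/-- The postulation number `n(I)`: the least integer `n` with `P_I(t) = H_I(t)` for all integers
`t > n`. -/
noncomputable def postulationNumber (I : Ideal R) : ℤ :=
  sInf {n : ℤ | ∀ t : ℤ, n < t → (hilbertPoly I).eval (t : ℚ) = (hilbertFun I t : ℚ)}

/-- `J` is a reduction of `I`. -/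
def IsReduction (I J : Ideal R) : Prop :=
  J ≤ I ∧ ∃ n : ℕ, J * I ^ n = I ^ (n + 1)

/-- `J` is a minimal reduction of `I`: minimal under inclusion among the reductions of `I`. -/
def IsMinimalReduction (I J : Ideal R) : Prop :=
  Minimal (IsReduction I) J

/-- The reduction number `rd_J(I)` of `I` with respect to a reduction `J`: the least `n ≥ 0` with
`J I ^ n = I ^ (n + 1)`. -/
noncomputable def reductionNumberWrt (I J : Ideal R) : ℕ :=
  sInf {n : ℕ | J * I ^ n = I ^ (n + 1)}

/-- The reduction number `rd(I)`: the minimum of `rd_J(I)` over all minimal reductions `J` of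
`I`. -/
noncomputable def reductionNumber (I : Ideal R) : ℕ :=
  sInf {r : ℕ | ∃ J : Ideal R, IsMinimalReduction I J ∧ reductionNumberWrt I J = r}

end RatliffRush

open IsLocalRing

namespace RatliffRush

/-! Take a minimal reduction `J` attaining `r = rd(I)`. Superficial elements exist because the
residue field is infinite, and depth 2 makes them regular, so `J` contains a reduction `(a, b)` with
`a` regular and superficial for `I` and `b` regular modulo `a` (`exists_superficial_pair`);
minimality gives `J = (a, b)`. Multiplication by `a` splits `H(n+1)` as `λ(R/(I^(n+1) : a)) +
λ(R/(I^(n+1) + (a)))`. For `n + 1 ≥ r` the second term is linear in `n` (`colength_pow_sup_add`),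
and for large `n` the first is `H(n)`; hence that linear function equals `P(n+1) - P(n)`. Suppose `r
≤ n(I) + 1` and `n(I) ≥ 0`. Then `λ(R/(I^(t+1) : a)) = P(t)` for all `t ≥ n(I)`, so `I^(t+1) : a =
I^t` holds for `t > n(I)` and fails at `t = n(I)`. By `closure_pow_eq` and `mem_pow_of_closure_eq`
these colons detect Ratliff-Rush closedness, so `ρ(I) = n(I) + 1`, which is excluded. A negative
`n(I)` would force `r = 0` and `n(I) = -1`, contradicted by direct computation. -/

/-! ### Avoiding finitely many submodules -/

/-- A finite module over a local ring with infinite residue field is not a finite union of proper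
submodules. -/
theorem exists_forall_notMem_of_ne_top {R M : Type*} [CommRing R] [IsLocalRing R]
    [Infinite (ResidueField R)] [AddCommGroup M] [Module R M] [Module.Finite R M]
    {F : Set (Submodule R M)} (hF : F.Finite) (htop : ⊤ ∉ F) : ∃ v, ∀ N ∈ F, v ∉ N := by
  classical
  by_contra! hcon
  have hcov : ⋃ N ∈ hF.toFinset,
      ((N ⊔ maximalIdeal R • ⊤ : Submodule R M) : Set M) = Set.univ := by
    refine Set.eq_univ_of_forall fun v => ?_
    obtain ⟨N, hN, hv⟩ := hcon v
    simp only [Set.mem_iUnion]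
    exact ⟨N, hF.mem_toFinset.2 hN, (le_sup_left : N ≤ N ⊔ maximalIdeal R • ⊤) hv⟩
  -- Some member of a finite cover by subgroups has finite index. Adding `𝔪M` keeps it proper by
  -- Nakayama, and a nonzero vector of the quotient then embeds the infinite residue field in a
  -- finite set.
  obtain ⟨N, hN, hfin⟩ := Submodule.exists_finiteIndex_of_cover hcov
  rw [hF.mem_toFinset] at hN
  set N' : Submodule R M := N ⊔ maximalIdeal R • ⊤ with hN'
  have hne : N' ≠ ⊤ := by
    intro h
    apply htop
    have : N = ⊤ := top_le_iff.1 <|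
      Submodule.le_of_le_smul_of_le_jacobson_bot (I := maximalIdeal R) Module.Finite.fg_top
        (by rw [jacobson_eq_maximalIdeal ⊥ bot_ne_top]) (by rw [← hN', h])
    rwa [← this]
  have : Finite (M ⧸ N') := AddSubgroup.finite_quotient_of_finiteIndex
  obtain ⟨v, hv⟩ : ∃ v, v ∉ N' := by
    by_contra! h
    exact hne (eq_top_iff.2 fun v _ => h v)
  let f : R →ₗ[R] M ⧸ N' := LinearMap.toSpanSingleton R _ (N'.mkQ v)
  have hker : maximalIdeal R = LinearMap.ker f := by
    refine (maximalIdeal.isMaximal R).eq_of_le ?_ ?_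
    · intro h
      have : (1 : R) ∈ LinearMap.ker f := h ▸ Submodule.mem_top
      simp [f] at this
      exact hv this
    · intro r hr
      have : r • v ∈ N' := (le_sup_right : _ ≤ N') (Submodule.smul_mem_smul hr trivial)
      simpa [f, ← Submodule.Quotient.mk_smul] using this
  have hinf : Infinite (R ⧸ maximalIdeal R) := ‹Infinite (ResidueField R)›
  rw [hker] at hinf
  exact not_finite_iff_infinite.2 hinf (Finite.of_injective _ (LinearMap.ker_eq_bot.1
    (Submodule.ker_liftQ_eq_bot (LinearMap.ker f) f le_rfl le_rfl)))

/-! ### Rees algebra and superficial elements -/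

variable {R : Type*} [CommRing R]

open Polynomial in
/-- The ideal of the Rees algebra of `I` consisting of the `f` with `i`-th coefficient in
`I ^ (i + 1) + L`; the quotient is the associated graded ring of the image of `I` in `R ⧸ L`. -/
def reesShift (I L : Ideal R) : Ideal (reesAlgebra I) where
  carrier := {f | ∀ i, (f : R[X]).coeff i ∈ I ^ (i + 1) ⊔ L}
  add_mem' {f g} hf hg i := by
    simpa using add_mem (hf i) (hg i)
  zero_mem' i := by simp
  smul_mem' f g hg i := by
    simp only [smul_eq_mul, MulMemClass.coe_mul, coeff_mul]
    refine sum_mem fun p hp => ?_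
    have h1 : (f : R[X]).coeff p.1 ∈ I ^ p.1 := f.2 p.1
    obtain ⟨u, hu, l, hl, hul⟩ := Submodule.mem_sup.1 (hg p.2)
    rw [← hul, mul_add]
    refine Submodule.add_mem_sup ?_ (L.mul_mem_left _ hl)
    have := Ideal.mul_mem_mul h1 hu
    rw [← pow_add] at this
    have h2 : p.1 + p.2 = i := Finset.HasAntidiagonal.mem_antidiagonal.1 hp
    rwa [show p.1 + (p.2 + 1) = i + 1 by omega] at this

/-- The homogeneous element `z t ^ n` of the Rees algebra. -/
noncomputable def reesMonomial {I : Ideal R} {n : ℕ} (z : R) (hz : z ∈ I ^ n) : reesAlgebra I :=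
  ⟨Polynomial.monomial n z, reesAlgebra.monomial_mem.2 hz⟩

theorem reesMonomial_mem_reesShift {I L : Ideal R} {n : ℕ} {z : R} (hz : z ∈ I ^ n) :
    reesMonomial z hz ∈ reesShift I L ↔ z ∈ I ^ (n + 1) ⊔ L := by
  constructor
  · intro h
    simpa [reesMonomial] using h n
  · intro h i
    simp only [reesMonomial, Polynomial.coeff_monomial]
    split_ifs with hi
    · rwa [← hi]
    · simp

/-- Multiplication by `t`, as a linear map from `I` to its Rees algebra. -/
noncomputable def reesMonomialOne (I : Ideal R) : I →ₗ[R] reesAlgebra I where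
  toFun a := reesMonomial (n := 1) a.1 (by simp)
  map_add' a b := Subtype.ext (by simp [reesMonomial])
  map_smul' r a := Subtype.ext (by simp [reesMonomial, Polynomial.smul_monomial])

/-- Used with `p` the radical of a primary component: once `p` contains `J t`, the component
contains `z t^n` for every `z` in `I^n` with `n` large. -/
theorem reesMonomial_mem_pow {I J : Ideal R} (hJI : J ≤ I) {p : Ideal (reesAlgebra I)}
    (hp : ∀ a (ha : a ∈ J), reesMonomialOne I ⟨a, hJI ha⟩ ∈ p) (k m : ℕ) :
    ∀ z ∈ J ^ k * I ^ m, ∀ hz : z ∈ I ^ (m + k), reesMonomial z hz ∈ p ^ k := by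
  suffices H : ∀ z ∈ J ^ k * I ^ m, ∃ hz : z ∈ I ^ (m + k), reesMonomial z hz ∈ p ^ k from
    fun z hz hz' => (H z hz).2
  induction k with
  | zero =>
    intro z hz
    exact ⟨by simpa using hz, by simp⟩
  | succ k ih =>
    intro z hz
    rw [pow_succ', mul_assoc] at hz
    refine Submodule.mul_induction_on hz ?_ ?_
    · intro a ha w hw
      obtain ⟨hw', hw''⟩ := ih w hw
      have haw : a * w ∈ I ^ (m + (k + 1)) := by
        rw [← add_assoc, pow_succ']
        exact Ideal.mul_mem_mul (hJI ha) hw'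
      refine ⟨haw, ?_⟩
      rw [pow_succ']
      convert Ideal.mul_mem_mul (hp a ha) hw'' using 1
      refine Subtype.ext ?_
      simp only [reesMonomial, reesMonomialOne, LinearMap.coe_mk, AddHom.coe_mk,
        MulMemClass.coe_mul, Polynomial.monomial_mul_monomial]
      rw [show 1 + (m + k) = m + (k + 1) by omega]
    · rintro x y ⟨hx, hx'⟩ ⟨hy, hy'⟩
      refine ⟨add_mem hx hy, ?_⟩
      convert add_mem hx' hy' using 1
      exact Subtype.ext (by simp [reesMonomial])

theorem mul_pow_eq_of_le {I J : Ideal R} {s n : ℕ} (h : J * I ^ s = I ^ (s + 1)) (hn : s ≤ n) :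
    J * I ^ n = I ^ (n + 1) := by
  obtain ⟨d, rfl⟩ := Nat.exists_eq_add_of_le hn
  rw [pow_add, ← mul_assoc, h, ← pow_add]
  congr 1
  omega

theorem pow_mul_pow_eq {I J : Ideal R} {s : ℕ} (h : J * I ^ s = I ^ (s + 1)) (k : ℕ) :
    J ^ k * I ^ s = I ^ (s + k) := by
  induction k with
  | zero => simp
  | succ k ih =>
    rw [pow_succ', mul_assoc, ih, mul_pow_eq_of_le h (by omega)]
    congr 1

/-- Existence of superficial elements in a reduction, modulo an ideal `L`, avoiding finitely many
given primes. -/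
theorem exists_superficial [IsLocalRing R] [IsNoetherianRing R] [Infinite (ResidueField R)]
    {I J : Ideal R} (L : Ideal R) (hJI : J ≤ I) {s : ℕ} (hJ : J * I ^ s = I ^ (s + 1))
    {T : Set (Ideal R)} (hT : T.Finite) (hJT : ∀ p ∈ T, ¬ J ≤ p) :
    ∃ b ∈ J, (∀ p ∈ T, b ∉ p) ∧ ∃ c, ∀ n, c ≤ n → ∀ z ∈ I ^ n,
      b * z ∈ I ^ (n + 2) ⊔ L → z ∈ I ^ (n + 1) ⊔ L := by
  classical
  -- Treat each primary component `q` separately. If `√q` contains `J t`, then `q` contains all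
  -- monomials of large degree; otherwise `b` is chosen with `b t ∉ √q`, so `b t` can be cancelled
  -- modulo `q`.
  obtain ⟨t, ht, htp⟩ := Submodule.isLasker (reesAlgebra I) (reesAlgebra I) (reesShift I L)
  let φ : J →ₗ[R] reesAlgebra I := reesMonomialOne I ∘ₗ Submodule.inclusion hJI
  let N : Ideal (reesAlgebra I) → Submodule R J := fun q =>
    (q.radical.restrictScalars R).comap φ
  let F : Set (Submodule R J) := (N '' t ∪ (fun p : Ideal R => Submodule.comap J.subtype p) '' T) \ {⊤}
  have hF : F.Finite := ((t.finite_toSet.image _).union (hT.image _)).subset Set.sdiff_subset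
  obtain ⟨⟨b, hb⟩, hbF⟩ := exists_forall_notMem_of_ne_top hF (by simp [F])
  refine ⟨b, hb, ?_, ?_⟩
  · intro p hp hbp
    refine hbF (Submodule.comap J.subtype p) ⟨Or.inr ⟨p, hp, rfl⟩, ?_⟩ hbp
    rw [Set.mem_singleton_iff, Submodule.comap_subtype_eq_top]
    exact hJT p hp
  · have hc : ∀ q ∈ t, ∃ c, ∀ n, c ≤ n → ∀ z (hz : z ∈ I ^ n),
        b * z ∈ I ^ (n + 2) ⊔ L → reesMonomial z hz ∈ q := by
      intro q hq
      by_cases hNq : N q = ⊤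
      · obtain ⟨k, hk⟩ := Ideal.exists_radical_pow_le_of_fg (I := q) (IsNoetherian.noetherian _)
        refine ⟨s + k, fun n hn z hz _ => hk ?_⟩
        obtain ⟨d, rfl⟩ := Nat.exists_eq_add_of_le hn
        have hz' : z ∈ J ^ k * I ^ (s + d) := by
          rwa [pow_add, ← mul_assoc, pow_mul_pow_eq hJ, ← pow_add]
        have hp : ∀ a (ha : a ∈ J), reesMonomialOne I ⟨a, hJI ha⟩ ∈ Ideal.radical q := by
          intro a ha
          have : (⟨a, ha⟩ : J) ∈ N q := hNq ▸ Submodule.mem_top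
          exact this
        have := reesMonomial_mem_pow hJI hp k (s + d) z hz'
        rw [show s + d + k = s + k + d by omega] at this
        exact this hz
      · refine ⟨0, fun n _ z hz hbz => ?_⟩
        have hbq : φ ⟨b, hb⟩ ∉ Ideal.radical q :=
          hbF (N q) ⟨Or.inl ⟨q, hq, rfl⟩, hNq⟩
        have hmul : reesMonomial z hz * φ ⟨b, hb⟩ ∈ q := by
          have hbz' : b * z ∈ I ^ (n + 1) := by
            rw [pow_succ']
            exact Ideal.mul_mem_mul (hJI hb) hz
          have hmem : reesMonomial (b * z) hbz' ∈ reesShift I L :=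
            (reesMonomial_mem_reesShift hbz').2 hbz
          rw [← ht, Submodule.mem_finsetInf] at hmem
          have hmem' : reesMonomial (b * z) hbz' ∈ q := hmem q hq
          convert hmem' using 1
          refine Subtype.ext ?_
          simp [φ, reesMonomial, reesMonomialOne, Polynomial.monomial_mul_monomial, mul_comm]
        exact ((Ideal.isPrimary_iff.1 (htp hq)).2 hmul).resolve_right hbq
    choose! c hc using hc
    refine ⟨t.sup c, fun n hn z hz hbz => ?_⟩
    rw [← reesMonomial_mem_reesShift hz, ← ht, Submodule.mem_finsetInf]
    exact fun q hq => hc q hq n ((Finset.le_sup hq).trans hn) z hz hbz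

/-- A superficial element that is regular modulo `L` has the expected colons. -/
theorem exists_colon_of_regular [IsNoetherianRing R] {I L : Ideal R} {b : R}
    (hreg : ∀ z, b * z ∈ L → z ∈ L) {c : ℕ}
    (hc : ∀ n, c ≤ n → ∀ z ∈ I ^ n, b * z ∈ I ^ (n + 2) ⊔ L → z ∈ I ^ (n + 1) ⊔ L) :
    ∃ c', ∀ n, c' ≤ n → ∀ z, b * z ∈ I ^ (n + 1) ⊔ L → z ∈ I ^ n ⊔ L := by
  have hstep : ∀ n j, c ≤ j → j + 1 ≤ n → ∀ z ∈ I ^ j ⊔ L, b * z ∈ I ^ (n + 1) ⊔ L →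
      z ∈ I ^ (j + 1) ⊔ L := by
    intro n j hj hjn z hz hbz
    obtain ⟨u, hu, l, hl, rfl⟩ := Submodule.mem_sup.1 hz
    refine add_mem (hc j hj u hu ?_) (Submodule.mem_sup_right hl)
    have h1 : b * u ∈ I ^ (n + 1) ⊔ L := by
      rw [mul_add] at hbz
      exact (Submodule.add_mem_iff_left _ (Submodule.mem_sup_right (L.mul_mem_left b hl))).1 hbz
    exact sup_le_sup_right (Ideal.pow_le_pow_right (by omega)) L h1
  have hup : ∀ n j, c ≤ j → j ≤ n → ∀ z ∈ I ^ c ⊔ L, b * z ∈ I ^ (n + 1) ⊔ L →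
      z ∈ I ^ j ⊔ L := by
    intro n j hj
    induction j, hj using Nat.le_induction with
    | base => exact fun _ z hz _ => hz
    | succ j hj ih => exact fun hn z hz hbz => hstep n j hj hn z (ih (by omega) z hz hbz) hbz
  -- Artin-Rees for the submodule `b(R/L)`, with regularity of `b`, puts `z` in `I^(n+1-k) + L`.
  -- From there `hup` raises the exponent to `n`.
  obtain ⟨k, hk⟩ := I.exists_pow_inf_eq_pow_smul (M := R ⧸ L)
    (LinearMap.range (LinearMap.lsmul R (R ⧸ L) b))
  have hmem : ∀ n z, Submodule.Quotient.mk z ∈ (I ^ n • ⊤ : Submodule R (R ⧸ L)) ↔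
      z ∈ I ^ n ⊔ L := by
    intro n z
    have : (I ^ n • ⊤ : Submodule R (R ⧸ L)) = Submodule.map L.mkQ (I ^ n) := by
      conv_rhs => rw [← Ideal.mul_top (I ^ n), ← smul_eq_mul, Submodule.map_smul'']
      rw [Submodule.map_top, Submodule.range_mkQ]
    rw [this]
    change L.mkQ z ∈ _ ↔ _
    rw [← Submodule.mem_comap, Submodule.comap_map_mkQ, sup_comm]
  refine ⟨k + c, fun n hn z hbz => hup n n (by omega) le_rfl z ?_ hbz⟩
  have h1 : (Submodule.Quotient.mk (b * z) : R ⧸ L) ∈ (I ^ (n + 1) • ⊤ : Submodule R (R ⧸ L)) ⊓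
      LinearMap.range (LinearMap.lsmul R (R ⧸ L) b) :=
    ⟨(hmem _ _).2 hbz, ⟨Submodule.Quotient.mk z, rfl⟩⟩
  rw [hk _ (by omega)] at h1
  have h2 : (Submodule.Quotient.mk (b * z) : R ⧸ L) ∈
      Submodule.map (LinearMap.lsmul R (R ⧸ L) b) (I ^ (n + 1 - k) • ⊤) := by
    rw [Submodule.map_smul'', Submodule.map_top]
    exact Submodule.smul_mono le_rfl inf_le_right h1
  obtain ⟨w, hw, hwz⟩ := h2
  obtain ⟨w, rfl⟩ := Submodule.Quotient.mk_surjective L w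
  have hw' := (hmem _ _).1 hw
  have hwz' : b * (z - w) ∈ L := by
    have : (Submodule.Quotient.mk (b * w) : R ⧸ L) = Submodule.Quotient.mk (b * z) := hwz
    rw [mul_sub]
    exact (Submodule.Quotient.eq L).1 this.symm
  have h3 : z ∈ I ^ (n + 1 - k) ⊔ L := by
    simpa using add_mem (Submodule.mem_sup_right (hreg _ hwz') : z - w ∈ I ^ (n + 1 - k) ⊔ L) hw'
  exact sup_le_sup_right (Ideal.pow_le_pow_right (by omega)) L h3

/-- If `𝔪` is not associated to `R ⧸ L`, a reduction containing a power of `𝔪` contains an element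
which is regular and superficial modulo `L`. -/
theorem exists_regular_superficial [IsLocalRing R] [IsNoetherianRing R]
    [Infinite (ResidueField R)] {I J L : Ideal R}
    (hL : ∀ z, (∀ u ∈ maximalIdeal R, u * z ∈ L) → z ∈ L) (hJI : J ≤ I) {s : ℕ}
    (hJ : J * I ^ s = I ^ (s + 1)) {k : ℕ} (hk : maximalIdeal R ^ k ≤ J) :
    ∃ b ∈ J, (∀ z, b * z ∈ L → z ∈ L) ∧
      ∃ c, ∀ n, c ≤ n → ∀ z, b * z ∈ I ^ (n + 1) ⊔ L → z ∈ I ^ n ⊔ L := by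
  -- An associated prime containing `J` would contain `𝔪`, which `hL` forbids.
  obtain ⟨b, hb, hbT, c, hc⟩ := exists_superficial L hJI hJ (associatedPrimes.finite R (R ⧸ L)) (by
    intro p hp hJp
    have hpp : p.IsPrime := hp.1
    obtain ⟨-, x, hx⟩ := Submodule.isAssociatedPrime_iff.1 hp
    obtain ⟨z, rfl⟩ := Submodule.Quotient.mk_surjective L x
    have hmem : ∀ u, u ∈ p ↔ u * z ∈ L := by
      intro u
      rw [hx, Submodule.mem_colon_singleton, ← Submodule.Quotient.mk_smul, Submodule.mem_bot,
        Submodule.Quotient.mk_eq_zero, smul_eq_mul]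
    have hmp : maximalIdeal R ≤ p := hpp.le_of_pow_le (hk.trans hJp)
    have hz := hL z fun u hu => (hmem u).1 (hmp hu)
    exact hpp.ne_top ((Ideal.eq_top_iff_one p).2 ((hmem 1).2 (by simpa using hz))))
  have hreg : ∀ z, b * z ∈ L → z ∈ L := by
    have h1 : b ∉ ⋃ p ∈ associatedPrimes R (R ⧸ L), (p : Set R) := by
      simpa using hbT
    rw [biUnion_associatedPrimes_eq_compl_regular, Set.mem_compl_iff, not_not] at h1
    intro z hz
    rw [← Submodule.Quotient.mk_eq_zero]
    refine (show IsSMulRegular (R ⧸ L) b from h1).right_eq_zero_of_smul ?_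
    rw [← Submodule.Quotient.mk_smul, Submodule.Quotient.mk_eq_zero]
    exact hz
  exact ⟨b, hb, hreg, exists_colon_of_regular hreg hc⟩

/-! ### Regular sequences and two-generated reductions in dimension 2 -/

/-- A Cohen-Macaulay local ring of dimension `2` has a regular sequence of length `2`. -/
theorem IsCohenMacaulayLocal.exists_pair [IsLocalRing R] (hR : IsCohenMacaulayLocal R)
    (hdim : ringKrullDim R = 2) :
    ∃ x ∈ maximalIdeal R, ∃ y ∈ maximalIdeal R, (∀ z, x * z = 0 → z = 0) ∧
      ∀ z, y * z ∈ Ideal.span {x} → z ∈ Ideal.span {x} := by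
  obtain ⟨rs, hmem, hreg, hlen⟩ := hR.exists_regular
  rw [hdim] at hlen
  have hlen' : rs.length = 2 := by exact_mod_cast hlen
  obtain ⟨x, y, rfl⟩ := List.length_eq_two.1 hlen'
  have h := hreg.toIsWeaklyRegular
  rw [RingTheory.Sequence.isWeaklyRegular_cons_iff, RingTheory.Sequence.isWeaklyRegular_cons_iff]
    at h
  obtain ⟨hx, hy, -⟩ := h
  refine ⟨x, hmem x (by simp), y, hmem y (by simp), fun z hz => hx.right_eq_zero_of_smul hz, ?_⟩
  have hspan : ∀ z, z ∈ Ideal.span {x} ↔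
      (Submodule.Quotient.mk z : QuotSMulTop x R) = 0 := by
    intro z
    rw [Submodule.Quotient.mk_eq_zero, ← Submodule.ideal_span_singleton_smul, smul_eq_mul,
      Ideal.mul_top]
  intro z hz
  rw [hspan] at hz ⊢
  exact hy.right_eq_zero_of_smul hz

theorem eq_zero_of_maximalIdeal_mul_eq_zero [IsLocalRing R] (hR : IsCohenMacaulayLocal R)
    (hdim : ringKrullDim R = 2) {z : R} (hz : ∀ u ∈ maximalIdeal R, u * z = 0) : z = 0 := by
  obtain ⟨x, hx, -, -, hreg, -⟩ := hR.exists_pair hdim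
  exact hreg z (hz x hx)

/-- In a Cohen-Macaulay local ring of dimension `2` the maximal ideal is not associated to the
quotient by a regular element. -/
theorem mem_span_of_maximalIdeal_mul_mem [IsLocalRing R] (hR : IsCohenMacaulayLocal R)
    (hdim : ringKrullDim R = 2) {a : R} (ha : ∀ z, a * z = 0 → z = 0) {z : R}
    (hz : ∀ u ∈ maximalIdeal R, u * z ∈ Ideal.span {a}) : z ∈ Ideal.span {a} := by
  obtain ⟨x, hx, y, hy, hxreg, hyreg⟩ := hR.exists_pair hdim
  -- Writing `x z = w a` carries a socle element `z` of `R/(a)` to a socle element `w` of `R/(x)`,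
  -- where `y` is regular.
  obtain ⟨w, hw⟩ := Ideal.mem_span_singleton'.1 (hz x hx)
  have hmw : ∀ u ∈ maximalIdeal R, u * w ∈ Ideal.span {x} := by
    intro u hu
    obtain ⟨s, hs⟩ := Ideal.mem_span_singleton'.1 (hz u hu)
    refine Ideal.mem_span_singleton'.2 ⟨s, ?_⟩
    have : a * (s * x - u * w) = 0 := by linear_combination x * hs - u * hw
    exact sub_eq_zero.1 (ha _ this)
  obtain ⟨v, hv⟩ := Ideal.mem_span_singleton'.1 (hyreg w (hmw y hy))
  refine Ideal.mem_span_singleton'.2 ⟨v, ?_⟩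
  have : x * (v * a - z) = 0 := by linear_combination a * hv + hw
  exact sub_eq_zero.1 (hxreg _ this)

/-- Each of the two nonzerodivisors lowers the dimension by at least one, so `R/(a, b)` is Artinian.
-/
theorem maximalIdeal_pow_le_of_regular [IsLocalRing R] [IsNoetherianRing R]
    (hdim : ringKrullDim R = 2) {a b : R} (ha : ∀ z, a * z = 0 → z = 0)
    (hb : ∀ z, b * z ∈ Ideal.span {a} → z ∈ Ideal.span {a}) :
    ∃ N, maximalIdeal R ^ N ≤ Ideal.span {a} ⊔ Ideal.span {b} := by
  let A := R ⧸ Ideal.span {a}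
  let b' : A := Ideal.Quotient.mk _ b
  have ha' : a ∈ nonZeroDivisors R := by
    rw [mem_nonZeroDivisors_iff_right]
    exact fun z hz => ha z (by rwa [mul_comm])
  have hb' : b' ∈ nonZeroDivisors A := by
    rw [mem_nonZeroDivisors_iff_right]
    intro z hz
    obtain ⟨z, rfl⟩ := Ideal.Quotient.mk_surjective z
    rw [← map_mul, Ideal.Quotient.eq_zero_iff_mem] at hz
    rw [Ideal.Quotient.eq_zero_iff_mem]
    exact hb z (by rwa [mul_comm])
  have h1 := ringKrullDim_quotient_succ_le_of_nonZeroDivisor ha'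
  have h2 := ringKrullDim_quotient_succ_le_of_nonZeroDivisor hb'
  have h3 : ringKrullDim (A ⧸ Ideal.span {b'}) ≤ 0 := by
    rw [hdim] at h1
    have h4 : ringKrullDim (A ⧸ Ideal.span {b'}) + 1 + 1 ≤ 2 := (by gcongr : _ ≤ _).trans h1
    rw [show (2 : WithBot ℕ∞) = 0 + 1 + 1 by norm_num] at h4
    exact (ENat.WithBot.add_le_add_one_right_iff).1
      ((ENat.WithBot.add_le_add_one_right_iff).1 h4)
  have : Ring.KrullDimLE 0 (A ⧸ Ideal.span {b'}) := by
    rw [Ring.KrullDimLE, Order.krullDimLE_iff]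
    exact_mod_cast h3
  have hart : IsArtinianRing (A ⧸ Ideal.span {b'}) :=
    IsNoetherianRing.isArtinianRing_of_krullDimLE_zero
  let f : R →+* A ⧸ Ideal.span {b'} := (Ideal.Quotient.mk _).comp (Ideal.Quotient.mk _)
  have hf : Function.Surjective f :=
    Ideal.Quotient.mk_surjective.comp Ideal.Quotient.mk_surjective
  have : IsArtinianRing (R ⧸ RingHom.ker f) :=
    (RingHom.quotientKerEquivOfSurjective hf).symm.surjective.isArtinianRing
  obtain ⟨N, hN⟩ := exists_maximalIdeal_pow_le_of_isArtinianRing_quotient (RingHom.ker f)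
  refine ⟨N, hN.trans fun z hz => ?_⟩
  have hz' : (Ideal.Quotient.mk (Ideal.span {a}) z) ∈ Ideal.span {b'} :=
    Ideal.Quotient.eq_zero_iff_mem.1 hz
  obtain ⟨v, hv⟩ := Ideal.mem_span_singleton'.1 hz'
  obtain ⟨v, rfl⟩ := Ideal.Quotient.mk_surjective v
  have : z - v * b ∈ Ideal.span {a} := by
    rw [← Ideal.Quotient.eq, ← hv, map_mul]
  rw [← sub_add_cancel z (v * b)]
  exact Submodule.add_mem_sup this (Ideal.mul_mem_left _ _ (Ideal.mem_span_singleton_self b))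

/-- Every reduction of an `𝔪`-primary ideal contains a two-generated reduction whose first
generator is regular and superficial and whose second generator is regular modulo the first. -/
theorem exists_superficial_pair [IsLocalRing R] [Infinite (ResidueField R)]
    (hR : IsCohenMacaulayLocal R) (hdim : ringKrullDim R = 2) {I J : Ideal R}
    (hJ : IsReduction I J) {k : ℕ} (hk : maximalIdeal R ^ k ≤ I) (hI : I ≤ maximalIdeal R) :
    ∃ a b, a ∈ J ∧ b ∈ J ∧ (∀ z, a * z = 0 → z = 0) ∧
      (∀ z, b * z ∈ Ideal.span {a} → z ∈ Ideal.span {a}) ∧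
      (∃ c, ∀ n, c ≤ n → ∀ z, a * z ∈ I ^ (n + 1) → z ∈ I ^ n) ∧
      IsReduction I (Ideal.span {a} ⊔ Ideal.span {b}) := by
  have := hR.noetherian
  obtain ⟨hJI, s, hs⟩ := hJ
  have hkJ : maximalIdeal R ^ (k * (s + 1)) ≤ J := by
    rw [pow_mul]
    exact (Ideal.pow_right_mono hk _).trans (hs.symm.le.trans Ideal.mul_le_left)
  obtain ⟨a, haJ, ha, ca, hca⟩ := exists_regular_superficial (L := ⊥)
    (fun z hz => by simpa using eq_zero_of_maximalIdeal_mul_eq_zero hR hdim hz) hJI hs hkJ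
  simp only [Submodule.mem_bot, sup_bot_eq] at ha hca
  obtain ⟨b, hbJ, hb, cb, hcb⟩ := exists_regular_superficial (L := Ideal.span {a})
    (fun z hz => mem_span_of_maximalIdeal_mul_mem hR hdim ha hz) hJI hs hkJ
  obtain ⟨N, hN⟩ := maximalIdeal_pow_le_of_regular hdim ha hb
  have hle : Ideal.span {a} ⊔ Ideal.span {b} ≤ I :=
    sup_le ((Ideal.span_singleton_le_iff_mem _).2 (hJI haJ))
      ((Ideal.span_singleton_le_iff_mem _).2 (hJI hbJ))
  -- The exponent exceeds both superficiality bounds, and `N` puts `I^(n+1)` inside `(a, b)`. In `z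
  -- = u a + v b`, first `v` is corrected modulo `a` to lie in `I^n`, then the coefficient of `a`
  -- follows.
  refine ⟨a, b, haJ, hbJ, ha, hb, ⟨ca, hca⟩, hle, ca + cb + N, le_antisymm ?_ ?_⟩
  · rw [pow_succ']
    exact Ideal.mul_mono_left hle
  · set n := ca + cb + N with hn
    intro z hz
    have hzN : z ∈ Ideal.span {a} ⊔ Ideal.span {b} :=
      hN (Ideal.pow_right_mono hI _ (Ideal.pow_le_pow_right (by omega) hz))
    obtain ⟨p, hp, q, hq, hpq⟩ := Submodule.mem_sup.1 hzN
    obtain ⟨v, rfl⟩ := Ideal.mem_span_singleton'.1 hq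
    have hv : b * v ∈ I ^ (n + 1) ⊔ Ideal.span {a} := by
      rw [show b * v = z - p by rw [← hpq]; ring]
      exact sub_mem (Submodule.mem_sup_left hz) (Submodule.mem_sup_right hp)
    obtain ⟨v', hv', l, hl, rfl⟩ := Submodule.mem_sup.1 (hcb n (by omega) v hv)
    obtain ⟨u, rfl⟩ := Ideal.mem_span_singleton'.1 hp
    obtain ⟨w, rfl⟩ := Ideal.mem_span_singleton'.1 hl
    have hbv' : b * v' ∈ I ^ (n + 1) := by
      rw [pow_succ']
      exact Ideal.mul_mem_mul (hJI hbJ) hv'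
    have huw : u + w * b ∈ I ^ n := by
      refine hca n (by omega) _ ?_
      rw [show a * (u + w * b) = z - b * v' by rw [← hpq]; ring]
      exact sub_mem hz hbv'
    rw [show z = a * (u + w * b) + b * v' by rw [← hpq]; ring]
    exact add_mem (Ideal.mul_mem_mul (Submodule.mem_sup_left (Ideal.mem_span_singleton_self a)) huw)
      (Ideal.mul_mem_mul (Submodule.mem_sup_right (Ideal.mem_span_singleton_self b)) hv')

/-! ### Existence of minimal reductions -/

/-- The image in `I / 𝔪 I` determines whether a subideal is a reduction. -/
theorem IsReduction.of_le_sup [IsLocalRing R] [IsNoetherianRing R] {I J K : Ideal R}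
    (hJ : IsReduction I J) (hK : K ≤ I) (hJK : J ≤ K ⊔ maximalIdeal R * I) : IsReduction I K := by
  obtain ⟨hJI, n, hn⟩ := hJ
  refine ⟨hK, n, le_antisymm (by rw [pow_succ']; exact Ideal.mul_mono_left hK) ?_⟩
  refine Submodule.le_of_le_smul_of_le_jacobson_bot (I := maximalIdeal R)
    (IsNoetherian.noetherian _) (by rw [jacobson_eq_maximalIdeal ⊥ bot_ne_top]) ?_
  calc I ^ (n + 1) = J * I ^ n := hn.symm
    _ ≤ (K ⊔ maximalIdeal R * I) * I ^ n := Ideal.mul_mono_left hJK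
    _ = K * I ^ n ⊔ maximalIdeal R • I ^ (n + 1) := by
      rw [Ideal.sup_mul, mul_assoc, ← pow_succ', smul_eq_mul]

/-- Ideals of a Noetherian local ring have minimal reductions. -/
theorem exists_isMinimalReduction [IsLocalRing R] [IsNoetherianRing R] (I : Ideal R) :
    ∃ J, IsMinimalReduction I J := by
  let V := I ⧸ (maximalIdeal R • ⊤ : Submodule R I)
  let : Field (R ⧸ maximalIdeal R) := Ideal.Quotient.field _
  have : Module.Finite (R ⧸ maximalIdeal R) V :=
    Module.Finite.of_restrictScalars_finite R _ _
  let π : I →ₗ[R] V := Submodule.mkQ _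
  let toIdeal : Submodule (R ⧸ maximalIdeal R) V → Ideal R := fun U =>
    ((U.restrictScalars R).comap π).map I.subtype
  -- A minimal subspace of the finite-dimensional space `I/𝔪I` whose preimage is a reduction; lifts
  -- of a basis of it will generate the minimal reduction.
  obtain ⟨U, hU, hmin⟩ := WellFounded.has_min
    (wellFounded_lt (α := Submodule (R ⧸ maximalIdeal R) V)) {U | IsReduction I (toIdeal U)}
    ⟨⊤, by
      have : toIdeal ⊤ = I := by simp [toIdeal]
      rw [Set.mem_ofPred_eq, this]
      exact ⟨le_rfl, 0, by simp⟩⟩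
  let e := Module.finBasis (R ⧸ maximalIdeal R) U
  have hlift : ∀ i, ∃ g : I, π g = (e i : V) := fun i => Submodule.mkQ_surjective _ _
  choose g hg using hlift
  have hπ : ∀ r : R, ∀ w : V, r • w = (Ideal.Quotient.mk (maximalIdeal R) r) • w := fun _ _ => rfl
  have hker : ∀ w : I, π w = 0 ↔ (w : R) ∈ maximalIdeal R * I := by
    intro w
    rw [Submodule.mkQ_apply, Submodule.Quotient.mk_eq_zero, Submodule.mem_smul_top_iff, smul_eq_mul]
  let J : Ideal R := Ideal.span (Set.range fun i => (g i : R))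
  have hJI : J ≤ I := Ideal.span_le.2 (by rintro - ⟨i, rfl⟩; exact (g i).2)
  have hcomb : ∀ z ∈ J, ∃ r : Fin _ → R, z = ∑ i, r i * (g i : R) := by
    intro z hz
    obtain ⟨r, hr⟩ := (Ideal.mem_span_range_iff_exists_fun).1 hz
    exact ⟨r, hr.symm⟩
  have hJred : IsReduction I J := by
    refine IsReduction.of_le_sup hU hJI ?_
    rintro - ⟨w, hw, rfl⟩
    have hw' : π w ∈ U := hw
    have hsum := congrArg (Subtype.val) (e.sum_repr ⟨π w, hw'⟩)
    choose r hr using fun i => Ideal.Quotient.mk_surjective (e.repr ⟨π w, hw'⟩ i)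
    have hz : π (w - ∑ i, r i • g i) = 0 := by
      rw [map_sub, map_sum, sub_eq_zero]
      simp only [map_smul, hg, hπ, hr]
      simp only [AddSubmonoidClass.coe_finsetSum, Submodule.coe_smul] at hsum
      exact hsum.symm
    rw [hker] at hz
    rw [Submodule.coe_subtype, ← sub_add_cancel (w : R) (∑ i, r i * g i), add_comm]
    refine Submodule.add_mem_sup (sum_mem fun i _ => J.mul_mem_left _
      (Ideal.subset_span ⟨i, rfl⟩)) ?_
    simpa using hz
  refine ⟨J, hJred, fun K hK hKJ => ?_⟩
  let W : Submodule (R ⧸ maximalIdeal R) V :=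
    Submodule.span _ (π '' {w | (w : R) ∈ K})
  have hWU : W ≤ U := by
    refine Submodule.span_le.2 ?_
    rintro - ⟨w, hw, rfl⟩
    obtain ⟨r, hr⟩ := hcomb _ (hKJ hw)
    have : w = ∑ i, r i • g i := Subtype.ext (by simpa using hr)
    rw [this, map_sum]
    refine sum_mem fun i _ => ?_
    rw [map_smul, hg, hπ]
    exact U.smul_mem _ (e i).2
  have hWK : ∀ w : I, π w ∈ W → (w : R) ∈ K ⊔ maximalIdeal R * I := by
    intro w hw
    have : ∀ v ∈ W, ∃ w : I, π w = v ∧ (w : R) ∈ K := by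
      intro v hv
      induction hv using Submodule.span_induction with
      | mem v hv => obtain ⟨w, hw, rfl⟩ := hv; exact ⟨w, rfl, hw⟩
      | zero => exact ⟨0, by simp, by simp⟩
      | add v v' _ _ h h' =>
        obtain ⟨w, rfl, hw⟩ := h
        obtain ⟨w', rfl, hw'⟩ := h'
        exact ⟨w + w', by simp, by simpa using add_mem hw hw'⟩
      | smul r v _ h =>
        obtain ⟨w, rfl, hw⟩ := h
        obtain ⟨r, rfl⟩ := Ideal.Quotient.mk_surjective r
        exact ⟨r • w, by rw [map_smul, hπ], by simpa using K.mul_mem_left r hw⟩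
    obtain ⟨w', hw', hK'⟩ := this _ hw
    have h0 : π (w - w') = 0 := by rw [map_sub, hw', sub_self]
    rw [hker] at h0
    rw [← sub_add_cancel (w : R) w', add_comm]
    exact Submodule.add_mem_sup hK' (by simpa using h0)
  have hWred : IsReduction I (toIdeal W) := by
    refine IsReduction.of_le_sup hK ?_ ?_
    · rintro - ⟨w, -, rfl⟩
      exact w.2
    · refine le_trans (fun z hz => ?_) le_sup_left
      exact ⟨⟨z, hK.1 hz⟩, Submodule.subset_span ⟨_, hz, rfl⟩, rfl⟩
  have hWU' : W = U := hWU.eq_of_not_lt fun h => hmin W hWred h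
  refine Submodule.le_of_le_smul_of_le_jacobson_bot (I := maximalIdeal R)
    (IsNoetherian.noetherian _) (by rw [jacobson_eq_maximalIdeal ⊥ bot_ne_top]) ?_
  intro z hz
  obtain ⟨r, hr⟩ := hcomb z hz
  have hzU : π ⟨z, hJI hz⟩ ∈ W := by
    have : (⟨z, hJI hz⟩ : I) = ∑ i, r i • g i := Subtype.ext (by simpa using hr)
    rw [hWU', this, map_sum]
    refine sum_mem fun i _ => ?_
    rw [map_smul, hg, hπ]
    exact U.smul_mem _ (e i).2
  obtain ⟨y, hy, v, hv, rfl⟩ := Submodule.mem_sup.1 (hWK _ hzU)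
  refine Submodule.add_mem_sup hy ?_
  have hvJ : v ∈ J := by simpa using sub_mem hz (hKJ hy)
  obtain ⟨s, hs⟩ := hcomb v hvJ
  -- Independence of the basis forces all `s i` into `𝔪`, that is `J ∩ 𝔪I = 𝔪J`; so `J ≤ K + 𝔪J` and
  -- Nakayama applies.
  have h0 : ∑ i, (Ideal.Quotient.mk (maximalIdeal R) (s i)) • e i = 0 := by
    have h1 : π (∑ i, s i • g i) = 0 := by
      rw [hker]
      have : ((∑ i, s i • g i : I) : R) = v := by simpa using hs.symm
      rwa [this]
    refine Subtype.ext ?_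
    rw [map_sum] at h1
    simp only [map_smul, hg, hπ] at h1
    simpa using h1
  have h2 := Fintype.linearIndependent_iff.1 e.linearIndependent _ h0
  rw [hs]
  exact sum_mem fun i _ => Ideal.mul_mem_mul (Ideal.Quotient.eq_zero_iff_mem.1 (h2 i))
    (Ideal.subset_span ⟨i, rfl⟩)

/-! ### Colengths and their growth modulo a regular element -/

open Polynomial

/-- Multiplication by `a` computes the length of `R ⧸ K`. -/
theorem length_quotient_eq (K : Ideal R) (a : R) :
    Module.length R (R ⧸ K) =
      Module.length R (R ⧸ K.colon {a}) + Module.length R (R ⧸ K ⊔ Ideal.span {a}) := by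
  have hle : K.colon {a} ≤ Submodule.comap (LinearMap.lsmul R R a) K := fun z hz => by
    rw [Submodule.mem_colon_singleton] at hz
    rwa [Submodule.mem_comap, LinearMap.lsmul_apply, smul_eq_mul, mul_comm, ← smul_eq_mul]
  -- The exact sequence `0 → R/(K : a) → R/K → R/(K + (a)) → 0`.
  refine Module.length_eq_add_of_exact (Submodule.mapQ _ K (LinearMap.lsmul R R a) hle)
    (Submodule.factor (le_sup_left : K ≤ K ⊔ Ideal.span {a})) ?_
    (Submodule.factor_surjective _) ?_
  · rw [← LinearMap.ker_eq_bot, LinearMap.ker_eq_bot']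
    intro z hz
    obtain ⟨z, rfl⟩ := Submodule.Quotient.mk_surjective _ z
    rw [Submodule.mapQ_apply, Submodule.Quotient.mk_eq_zero] at hz
    rw [Submodule.Quotient.mk_eq_zero, Submodule.mem_colon_singleton, smul_eq_mul, mul_comm]
    exact hz
  · intro z
    obtain ⟨z, rfl⟩ := Submodule.Quotient.mk_surjective _ z
    change (Submodule.Quotient.mk z : R ⧸ K ⊔ Ideal.span {a}) = 0 ↔ _
    rw [Submodule.Quotient.mk_eq_zero]
    constructor
    · intro hz
      obtain ⟨y, hy, l, hl, rfl⟩ := Submodule.mem_sup.1 hz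
      obtain ⟨w, rfl⟩ := Ideal.mem_span_singleton'.1 hl
      refine ⟨Submodule.Quotient.mk w, ?_⟩
      rw [Submodule.mapQ_apply, Submodule.Quotient.eq]
      have : LinearMap.lsmul R R a w - (y + w * a) = -y := by
        simp only [LinearMap.lsmul_apply, smul_eq_mul]
        ring
      rw [this]
      exact neg_mem hy
    · rintro ⟨w, hw⟩
      obtain ⟨w, rfl⟩ := Submodule.Quotient.mk_surjective _ w
      rw [Submodule.mapQ_apply, Submodule.Quotient.eq] at hw
      have h1 : a * w - z ∈ K := hw
      rw [show z = -(a * w - z) + w * a by ring]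
      exact Submodule.add_mem_sup (neg_mem h1)
        (Ideal.mul_mem_left _ _ (Ideal.mem_span_singleton_self a))

/-- The quotient by an ideal containing a power of the maximal ideal has finite length. -/
theorem length_quotient_ne_top [IsLocalRing R] [IsNoetherianRing R] {K : Ideal R} {k : ℕ}
    (hk : maximalIdeal R ^ k ≤ K) : Module.length R (R ⧸ K) ≠ ⊤ := by
  have : Ring.KrullDimLE 0 (R ⧸ K) := by
    refine Ring.KrullDimLE.mk₀ fun P hP => ?_
    have h1 : maximalIdeal R ≤ P.comap (Ideal.Quotient.mk K) := by
      refine (hP.comap (Ideal.Quotient.mk K)).le_of_pow_le (hk.trans fun z hz => ?_)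
      rw [Ideal.mem_comap, Ideal.Quotient.eq_zero_iff_mem.2 hz]
      exact P.zero_mem
    have h2 := (maximalIdeal.isMaximal R).eq_of_le (hP.comap (Ideal.Quotient.mk K)).ne_top h1
    have h3 : (P.comap (Ideal.Quotient.mk K)).IsMaximal := h2 ▸ maximalIdeal.isMaximal R
    rw [← Ideal.map_comap_of_surjective _ Ideal.Quotient.mk_surjective P]
    exact h3.map_of_surjective_of_ker_le Ideal.Quotient.mk_surjective (Ideal.ker_le_comap _)
  have : IsArtinianRing (R ⧸ K) := IsNoetherianRing.isArtinianRing_of_krullDimLE_zero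
  rw [Module.length_eq_of_surjective (S := R) (R := R ⧸ K) Ideal.Quotient.mk_surjective]
  exact Module.length_ne_top

/-- The length of `R ⧸ K` as a natural number. -/
noncomputable def colength (K : Ideal R) : ℕ := (Module.length R (R ⧸ K)).toNat

section colength

variable [IsLocalRing R] [IsNoetherianRing R] {K K' : Ideal R} {k : ℕ}

theorem colength_eq_add (hk : maximalIdeal R ^ k ≤ K) (a : R) :
    colength K = colength (K.colon {a}) + colength (K ⊔ Ideal.span {a}) := by
  rw [colength, length_quotient_eq K a, ENat.toNat_add
    (length_quotient_ne_top (hk.trans Ideal.le_colon))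
    (length_quotient_ne_top (hk.trans le_sup_left))]
  rfl

/-- The kernel of `R/K → R/K'` has length zero by additivity. Finiteness permits the cancellation
and ensures that `toNat` loses nothing. -/
theorem eq_of_colength_eq (hk : maximalIdeal R ^ k ≤ K) (hKK' : K ≤ K')
    (h : colength K = colength K') : K = K' := by
  refine le_antisymm hKK' ?_
  have hfin := length_quotient_ne_top hk
  have hfin' := length_quotient_ne_top (hk.trans hKK')
  have hlen : Module.length R (R ⧸ K) = Module.length R (R ⧸ K') := by
    rw [← ENat.natCast_toNat hfin, ← ENat.natCast_toNat hfin']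
    exact congrArg _ h
  have hsurj := Submodule.factor_surjective hKK'
  have hadd := Module.length_eq_add_of_exact (LinearMap.ker (Submodule.factor hKK')).subtype
    (Submodule.factor hKK') (Submodule.subtype_injective _) hsurj
    (LinearMap.exact_subtype_ker_map _)
  rw [hlen] at hadd
  have h0 : Module.length R (LinearMap.ker (Submodule.factor hKK')) = 0 := by
    have h1 : Module.length R (LinearMap.ker (Submodule.factor hKK')) + Module.length R (R ⧸ K') =
        0 + Module.length R (R ⧸ K') := by rw [← hadd, zero_add]
    exact WithTop.add_right_cancel hfin' h1
  rw [Module.length_eq_zero_iff, Submodule.subsingleton_iff_eq_bot] at h0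
  intro z hz
  rw [← Submodule.Quotient.mk_eq_zero, ← Submodule.mem_bot R, ← h0, LinearMap.mem_ker]
  exact (Submodule.Quotient.mk_eq_zero K').2 hz

theorem colength_ne_zero (hk : maximalIdeal R ^ k ≤ K) (hK : K ≠ ⊤) : colength K ≠ 0 := by
  intro h
  refine hK (eq_of_colength_eq hk le_top (h.trans ?_))
  have : Subsingleton (R ⧸ (⊤ : Ideal R)) := Ideal.Quotient.subsingleton_iff.2 rfl
  simp [colength]

end colength

/-- Modulo `a`, the ideal `I^(n+1)` is `b I^n`, and `b` cancels. -/
theorem colon_pow_sup_eq {I : Ideal R} {a b : R} {n : ℕ}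
    (hb : ∀ z, b * z ∈ Ideal.span {a} → z ∈ Ideal.span {a})
    (hn : (Ideal.span {a} ⊔ Ideal.span {b}) * I ^ n = I ^ (n + 1)) :
    (I ^ (n + 1) ⊔ Ideal.span {a}).colon {b} = I ^ n ⊔ Ideal.span {a} := by
  ext z
  rw [Submodule.mem_colon_singleton, smul_eq_mul, ← hn, Ideal.sup_mul]
  constructor
  · intro hz
    obtain ⟨y, hy, l, hl, hyl⟩ := Submodule.mem_sup.1 hz
    obtain ⟨p, hp, q, hq, hpq⟩ := Submodule.mem_sup.1 hy
    obtain ⟨w, hw, hwq⟩ := Ideal.mem_span_singleton_mul.1 hq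
    have h2 : b * (z - w) ∈ Ideal.span {a} := by
      rw [show b * (z - w) = p + l by linear_combination -hyl - hpq - hwq]
      exact add_mem (Ideal.mul_le_left hp) hl
    rw [show z = w + (z - w) by ring]
    exact Submodule.add_mem_sup hw (hb _ h2)
  · intro hz
    obtain ⟨w, hw, l, hl, rfl⟩ := Submodule.mem_sup.1 hz
    rw [add_mul]
    refine Submodule.add_mem_sup (Submodule.mem_sup_right ?_) (Ideal.mul_mem_right _ _ hl)
    rw [mul_comm w b]
    exact Ideal.mul_mem_mul (Ideal.mem_span_singleton_self b) hw

/-- Modulo `a`, the Hilbert function of `I` grows linearly from the reduction number on. -/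
theorem colength_pow_sup_add [IsLocalRing R] [IsNoetherianRing R] {I : Ideal R} {k r : ℕ}
    (hk : maximalIdeal R ^ k ≤ I) {a b : R} (hb : ∀ z, b * z ∈ Ideal.span {a} → z ∈ Ideal.span {a})
    (hr : (Ideal.span {a} ⊔ Ideal.span {b}) * I ^ r = I ^ (r + 1)) (d : ℕ) :
    colength (I ^ (r + d) ⊔ Ideal.span {a}) =
      colength (I ^ r ⊔ Ideal.span {a}) + d * colength (Ideal.span {a} ⊔ Ideal.span {b}) := by
  induction d with
  | zero => simp
  | succ d ih =>
    have hn := mul_pow_eq_of_le hr (Nat.le_add_right r d)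
    rw [← add_assoc]
    set n := r + d
    have hkn : maximalIdeal R ^ (k * (n + 1)) ≤ I ^ (n + 1) ⊔ Ideal.span {a} := by
      rw [pow_mul]
      exact (Ideal.pow_right_mono hk _).trans le_sup_left
    -- Splitting along `b` leaves `I^n + (a)` as the colon and `(a, b)` as the sum, so each step
    -- adds the same constant.
    rw [colength_eq_add hkn b]
    have h1 := colon_pow_sup_eq hb hn
    have h2 : I ^ (n + 1) ⊔ Ideal.span {a} ⊔ Ideal.span {b} =
        Ideal.span {a} ⊔ Ideal.span {b} := by
      rw [sup_assoc, sup_eq_right, ← hn]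
      exact Ideal.mul_le_left
    rw [h1, h2, ih]
    ring

/-! ### Ratliff-Rush closure and colons -/

theorem mem_of_pow_mul_mem {I : Ideal R} {a : R} {m : ℕ}
    (hcol : ∀ t, m ≤ t → ∀ z, a * z ∈ I ^ (t + 1) → z ∈ I ^ t) (j : ℕ) :
    ∀ z, a ^ j * z ∈ I ^ (m + j) → z ∈ I ^ m := by
  induction j with
  | zero => intro z hz; simpa using hz
  | succ j ih =>
    intro z hz
    refine ih z (hcol (m + j) (by omega) _ ?_)
    rwa [← mul_assoc, ← pow_succ', add_assoc]

/-- If the colons by `a` behave well from `m` on, then `I ^ m` is Ratliff-Rush closed. -/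
theorem closure_pow_eq {I : Ideal R} {a : R} (ha : a ∈ I) {m : ℕ}
    (hcol : ∀ t, m ≤ t → ∀ z, a * z ∈ I ^ (t + 1) → z ∈ I ^ t) : closure (I ^ m) = I ^ m := by
  refine le_antisymm (iSup₂_le fun j _ z hz => ?_) ?_
  · refine mem_of_pow_mul_mem hcol (m * j) z ?_
    rw [Submodule.mem_colon] at hz
    have := hz (a ^ (m * j)) (by rw [← pow_mul]; exact Ideal.pow_mem_pow ha _)
    rw [smul_eq_mul, ← pow_mul] at this
    rwa [mul_comm z, show m * (j + 1) = m + m * j by ring] at this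
  · refine le_trans ?_ (le_iSup₂_of_le 1 le_rfl le_rfl)
    intro z hz
    rw [Submodule.mem_colon]
    intro w hw
    rw [pow_succ', smul_eq_mul]
    exact Ideal.mul_mem_mul hz hw

/-- If `I ^ t` is Ratliff-Rush closed, then the colon of `I ^ (t + 1)` by a regular superficial
element is `I ^ t`. -/
theorem mem_pow_of_closure_eq {I : Ideal R} {a : R} {c : ℕ}
    (hcol : ∀ n, c ≤ n → ∀ z, a * z ∈ I ^ (n + 1) → z ∈ I ^ n) {t : ℕ} (ht : 1 ≤ t)
    (hcl : closure (I ^ t) = I ^ t) {z : R} (hz : a * z ∈ I ^ (t + 1)) : z ∈ I ^ t := by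
  rw [← hcl]
  -- For `w` in `I^(t(c+1))`, the product `a z w` lies in `I^(t(c+2)+1)`. Since `t ≥ 1`, this
  -- exponent is in the range where superficiality cancels `a`.
  refine (le_iSup₂_of_le (c + 1) (by omega) le_rfl :
    ((I ^ t) ^ (c + 1 + 1)).colon (((I ^ t) ^ (c + 1) : Ideal R) : Set R) ≤ closure (I ^ t)) ?_
  rw [Submodule.mem_colon]
  intro w hw
  rw [SetLike.mem_coe, ← pow_mul] at hw
  rw [← pow_mul, smul_eq_mul]
  refine hcol _ (by nlinarith) _ ?_
  rw [← mul_assoc, show t * (c + 1 + 1) + 1 = (t + 1) + t * (c + 1) by ring, pow_add]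
  exact Ideal.mul_mem_mul hz hw

/-! ### Hilbert-Samuel polynomial and postulation number -/

theorem hilbertFun_natCast (I : Ideal R) (n : ℕ) : hilbertFun I n = colength (I ^ n) := by
  simp [hilbertFun, colength]

theorem hilbertFun_of_nonpos (I : Ideal R) {t : ℤ} (ht : t ≤ 0) : hilbertFun I t = 0 := by
  have : Subsingleton (R ⧸ (1 : Ideal R)) := Ideal.Quotient.subsingleton_iff.2 Ideal.one_eq_top
  rw [hilbertFun, Int.toNat_of_nonpos ht, pow_zero, Module.length_eq_zero]
  rfl

/-- A polynomial that agrees with the Hilbert-Samuel function eventually is the Hilbert-Samuel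
polynomial. -/
theorem hilbertPoly_eq {I : Ideal R} {Q : ℚ[X]} {N : ℤ}
    (hQ : ∀ n : ℤ, N ≤ n → Q.eval (n : ℚ) = hilbertFun I n) : hilbertPoly I = Q := by
  have hex : ∃ P : ℚ[X], ∃ N : ℤ, ∀ n : ℤ, N ≤ n → P.eval (n : ℚ) = (hilbertFun I n : ℚ) :=
    ⟨Q, N, hQ⟩
  rw [hilbertPoly, dif_pos hex]
  obtain ⟨N', hN'⟩ := hex.choose_spec
  refine Polynomial.eq_of_infinite_eval_eq _ _ (Set.Infinite.mono ?_
    ((Set.Ici_infinite (max N N')).image (f := ((↑) : ℤ → ℚ)) Int.cast_injective.injOn))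
  rintro - ⟨n, hn, rfl⟩
  exact (hN' n ((le_max_right _ _).trans hn)).trans (hQ n ((le_max_left _ _).trans hn)).symm

/-- A function on the integers with eventually linear differences is eventually quadratic. -/
theorem exists_quadratic (f : ℤ → ℚ) (α β : ℚ) (N : ℤ)
    (hf : ∀ n, N ≤ n → f (n + 1) = f n + (α + β * n)) :
    ∃ Q : ℚ[X], (∀ n : ℤ, N ≤ n → Q.eval (n : ℚ) = f n) ∧
      ∀ n : ℤ, Q.eval ((n + 1 : ℤ) : ℚ) = Q.eval (n : ℚ) + (α + β * n) := by
  -- `g` solves the difference equation; the constant term of `Q` fixes the value at `N`.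
  let g : ℚ → ℚ := fun q => β * (q * (q - 1) / 2) + α * q
  let Q : ℚ[X] := C (β / 2) * (X * (X - C 1)) + C α * X + C (f N - g N)
  have hev : ∀ q : ℚ, Q.eval q = g q + (f N - g N) := by
    intro q
    simp [Q, g]
    ring
  have hstep : ∀ n : ℤ, Q.eval ((n + 1 : ℤ) : ℚ) = Q.eval (n : ℚ) + (α + β * n) := by
    intro n
    rw [hev, hev]
    simp only [g]
    push_cast
    ring
  refine ⟨Q, fun n hn => ?_, hstep⟩
  induction n, hn using Int.leInduction with
  | base => rw [hev]; ring
  | succ n hn ih => rw [hstep, ih, hf n hn]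

/-- The defining property of the postulation number, for a Hilbert-Samuel polynomial that does not
agree with the Hilbert-Samuel function everywhere. -/
theorem postulationNumber_spec {I : Ideal R} {N : ℤ}
    (hN : ∀ t : ℤ, N ≤ t → (hilbertPoly I).eval (t : ℚ) = hilbertFun I t)
    (hne : ∃ t : ℤ, (hilbertPoly I).eval (t : ℚ) ≠ hilbertFun I t) :
    (∀ t : ℤ, postulationNumber I < t → (hilbertPoly I).eval (t : ℚ) = hilbertFun I t) ∧
      (hilbertPoly I).eval (postulationNumber I : ℚ) ≠ hilbertFun I (postulationNumber I) := by
  set S : Set ℤ := {n : ℤ | ∀ t : ℤ, n < t → (hilbertPoly I).eval (t : ℚ) = (hilbertFun I t : ℚ)}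
    with hS
  have hnon : S.Nonempty := ⟨N, fun t ht => hN t ht.le⟩
  obtain ⟨t₀, ht₀⟩ := hne
  -- Without a lower bound the integer `sInf` would be a meaningless default.
  have hbdd : BddBelow S := ⟨t₀, fun n hn => not_lt.1 fun h => ht₀ (hn t₀ h)⟩
  have hmem : postulationNumber I ∈ S := Int.csInf_mem hnon hbdd
  refine ⟨hmem, fun heq => ?_⟩
  have h1 : postulationNumber I - 1 ∈ S := by
    intro t ht
    rcases eq_or_lt_of_le (show postulationNumber I ≤ t by omega) with rfl | h
    · exact heq
    · exact hmem t h
  have h2 : postulationNumber I ≤ postulationNumber I - 1 := csInf_le hbdd h1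
  omega

theorem mem_pow_of_colon_eq {I : Ideal R} {a : R} {t : ℕ} (h : I ^ t = (I ^ (t + 1)).colon {a})
    (z : R) (hz : a * z ∈ I ^ (t + 1)) : z ∈ I ^ t := by
  rw [h, Submodule.mem_colon_singleton, smul_eq_mul, mul_comm]
  exact hz

end RatliffRush

/-! ### The main theorem -/

open RatliffRush in
theorem theorem3p4 {R : Type*} [CommRing R] [IsLocalRing R]
    [Infinite (IsLocalRing.ResidueField R)]
    (hR : RatliffRush.IsCohenMacaulayLocal R) (hdim : ringKrullDim R = 2)
    (I : Ideal R) (hI : RatliffRush.IsMaxPrimary I)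
    (x : R) (hx : RatliffRush.IsSuperficial I x)
    (h : RatliffRush.postulationNumber I ≠ (RatliffRush.stabilityIndex I : ℤ) - 1) :
    RatliffRush.postulationNumber I + 2 ≤ (RatliffRush.reductionNumber I : ℤ) := by
  have := hR.noetherian
  obtain ⟨k, hk⟩ := I.exists_radical_pow_le_of_fg (IsNoetherian.noetherian _)
  rw [hI.2] at hk
  have hIm : I ≤ maximalIdeal R := hI.2 ▸ Ideal.le_radical
  have hIpow : ∀ n, maximalIdeal R ^ (k * n) ≤ I ^ n := fun n => by
    rw [pow_mul]
    exact Ideal.pow_right_mono hk n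
  obtain ⟨J₀, hJ₀⟩ := exists_isMinimalReduction I
  obtain ⟨J, hJ, hJr⟩ : ∃ J, IsMinimalReduction I J ∧
      reductionNumberWrt I J = reductionNumber I := Nat.sInf_mem
    (s := {r | ∃ J : Ideal R, IsMinimalReduction I J ∧ reductionNumberWrt I J = r}) ⟨_, J₀, hJ₀, rfl⟩
  have hr : J * I ^ reductionNumberWrt I J = I ^ (reductionNumberWrt I J + 1) :=
    Nat.sInf_mem (s := {n : ℕ | J * I ^ n = I ^ (n + 1)}) hJ.1.2
  rw [hJr] at hr
  obtain ⟨a, b, haJ, hbJ, ha, hb, ⟨c, hc⟩, hab⟩ := exists_superficial_pair hR hdim hJ.1 hk hIm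
  have habJ : J = Ideal.span {a} ⊔ Ideal.span {b} :=
    le_antisymm (hJ.2 hab (sup_le ((Ideal.span_singleton_le_iff_mem _).2 haJ)
      ((Ideal.span_singleton_le_iff_mem _).2 hbJ))) (sup_le
        ((Ideal.span_singleton_le_iff_mem _).2 haJ) ((Ideal.span_singleton_le_iff_mem _).2 hbJ))
  have haI : a ∈ I := hJ.1.1 haJ
  rw [habJ] at hr
  set r := reductionNumber I
  set e := colength (Ideal.span {a} ⊔ Ideal.span {b})
  have hlin := colength_pow_sup_add hk hb hr
  have hcolon_le : ∀ n, I ^ n ≤ (I ^ (n + 1)).colon {a} := by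
    intro n z hz
    rw [Submodule.mem_colon_singleton, smul_eq_mul, pow_succ]
    exact Ideal.mul_mem_mul hz haI
  have hcolon : ∀ n, c ≤ n → (I ^ (n + 1)).colon {a} = I ^ n := by
    refine fun n hn => le_antisymm (fun z hz => hc n hn z ?_) (hcolon_le n)
    rwa [Submodule.mem_colon_singleton, smul_eq_mul, mul_comm] at hz
  set h₀ := colength (I ^ r ⊔ Ideal.span {a})
  -- the difference of the Hilbert function, from the reduction number on
  have hdiff : ∀ n : ℕ, r ≤ n + 1 → (hilbertFun I ((n + 1 : ℕ) : ℤ) : ℚ) =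
      colength ((I ^ (n + 1)).colon {a}) + ((h₀ + (1 - r) * e : ℚ) + e * n) := by
    intro n hn
    obtain ⟨d, hd⟩ := Nat.exists_eq_add_of_le hn
    have hd' : (n : ℚ) + 1 = r + d := by exact_mod_cast hd
    rw [hilbertFun_natCast, colength_eq_add (hIpow _) a]
    conv_lhs => rw [show I ^ (n + 1) ⊔ Ideal.span {a} = I ^ (r + d) ⊔ Ideal.span {a} by rw [hd],
      hlin d]
    push_cast
    linear_combination e * (-hd')
  obtain ⟨Q, hQ, hQstep⟩ := exists_quadratic (fun n => (hilbertFun I n : ℚ)) (h₀ + (1 - r) * e) e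
    (c + r : ℕ) (by
      intro n hn
      obtain ⟨n, rfl⟩ := Int.eq_ofNat_of_zero_le (show 0 ≤ n by omega)
      have h1 := hdiff n (by omega)
      rw [hcolon n (by omega), ← hilbertFun_natCast] at h1
      push_cast at h1 ⊢
      exact h1)
  have hPQ : hilbertPoly I = Q := hilbertPoly_eq hQ
  obtain ⟨hpost, hpost'⟩ := postulationNumber_spec (I := I) (N := (c + r : ℕ))
    (by rw [hPQ]; exact hQ) (by
      -- Agreement everywhere would make `P` vanish at all nonpositive integers, hence be zero,
      -- against `λ(R/I) ≠ 0`.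
      by_contra! hall
      have h0 : hilbertPoly I = 0 := by
        refine Polynomial.eq_zero_of_infinite_isRoot _ (Set.Infinite.mono ?_
          ((Set.Iic_infinite (0 : ℤ)).image (f := ((↑) : ℤ → ℚ)) Int.cast_injective.injOn))
        rintro - ⟨t, ht, rfl⟩
        change Polynomial.eval _ _ = 0
        rw [hall t, hilbertFun_of_nonpos I ht]
        simp
      have h1 := hall (1 : ℕ)
      rw [h0, hilbertFun_natCast, Polynomial.eval_zero, pow_one] at h1
      have hItop : I ≠ ⊤ := fun hI' =>
        (maximalIdeal.isMaximal R).ne_top (top_le_iff.1 (hI' ▸ hIm))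
      exact colength_ne_zero hk hItop (by exact_mod_cast h1.symm))
  rw [hPQ] at hpost hpost'
  by_contra! hlt
  rcases lt_or_ge (postulationNumber I) 0 with hneg | hnonneg
  -- Here `Q(0) - Q(-1) = h₀ + e - e = h₀`, which is `0` because `I^0 = R`; thus `Q(-1) = 0 =
  -- H(-1)`.
  · have hr0 : r = 0 := by omega
    have hn1 : postulationNumber I = -1 := by omega
    rw [hn1] at hpost hpost'
    have h1 := hQstep (-1)
    rw [show (-1 + 1 : ℤ) = 0 by norm_num, hpost 0 (by norm_num),
      hilbertFun_of_nonpos I le_rfl] at h1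
    have hh₀ : h₀ = 0 := by
      have : I ^ r ⊔ Ideal.span {a} = I ^ 0 := by simp [hr0]
      have h2 : h₀ = hilbertFun I ((0 : ℕ) : ℤ) := by rw [hilbertFun_natCast, ← this]
      rw [h2, hilbertFun_of_nonpos I (by simp)]
    rw [hilbertFun_of_nonpos I (by norm_num)] at hpost'
    apply hpost'
    rw [hh₀, hr0] at h1
    push_cast at h1 ⊢
    linarith
  · obtain ⟨n, hn⟩ := Int.eq_ofNat_of_zero_le hnonneg
    rw [hn] at hpost hpost' hlt h
    -- The bound `r ≤ n + 1` is exactly what lets `hdiff` start at `t = n`.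
    have hcolen : ∀ t : ℕ, n ≤ t → (colength ((I ^ (t + 1)).colon {a}) : ℚ) = Q.eval (t : ℚ) := by
      intro t ht
      have h1 := hdiff t (by omega)
      have h2 := hQstep t
      rw [← hpost ((t + 1 : ℕ) : ℤ) (by push_cast; omega)] at h1
      push_cast at h1 h2
      linarith
    have hgood : ∀ t : ℕ, n + 1 ≤ t → ∀ z, a * z ∈ I ^ (t + 1) → z ∈ I ^ t := by
      intro t ht
      refine mem_pow_of_colon_eq (eq_of_colength_eq (hIpow t) (hcolon_le t) ?_)
      have h1 := hcolen t (by omega)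
      have h2 := hpost t (by omega)
      rw [hilbertFun_natCast] at h2
      rw [Int.cast_natCast] at h2
      exact_mod_cast (h1.trans h2).symm
    -- Equality of the colon at `n` would extend the agreement of `Q` and `H` down to `n`.
    have hbad : ¬ ∀ z, a * z ∈ I ^ (n + 1) → z ∈ I ^ n := by
      intro hall
      have h1 : (I ^ (n + 1)).colon {a} = I ^ n := by
        refine le_antisymm (fun z hz => hall z ?_) (hcolon_le n)
        rwa [Submodule.mem_colon_singleton, smul_eq_mul, mul_comm] at hz
      have h2 := hcolen n le_rfl
      rw [h1] at h2
      apply hpost'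
      rw [hilbertFun_natCast]
      exact_mod_cast h2.symm
    have hρ : stabilityIndex I = n + 1 := by
      refine IsLeast.csInf_eq ⟨⟨by omega, fun m hm => closure_pow_eq haI fun t ht =>
        hgood t (by omega)⟩, ?_⟩
      rintro i ⟨hi1, hi⟩
      by_contra! hin
      exact hbad fun z hz => mem_pow_of_closure_eq hc (by omega) (hi n (by omega)) hz
    apply h
    rw [hρ]
    push_cast
    ring
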